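/- Let $B=2$. A camel walks in the desert $[0,\infty)$, whose border is position $0$. It can carry at most $B$ (indivisible) bananas on its back and can have at most $2$ bananas at a time in its stomach. For each mile the camel walks, the amount of banana fuel in its stomach decreases by $1$; it cannot walk with an empty stomach. It may eat a banana (from its back, or lying at its position) only when the amount in its stomach is at most $1$, which then increases by $1$. It may pick up bananas that lie at its position, and may lay down bananas from its back anywhere. There is a stock of $N$ bananas at the border, where the camel starts; for real $N$ this means that $\lfloor N\rfloor$ bananas lie at the border and the camel starts with $N-\lfloor N\rfloor$ banana units in its stomach. In the round trip variant, the camel penetrates $d$ miles into the desert if, by finitely many such actions, it gets to position $d$ and returns to the border afterwards. Define $p_2:\mathbb R\to(0,\infty)$ by $$p_2(x)=2^{\lfloor x\rfloor}\bigl(1+x-\lfloor x\rfloor\bigr),$$ which is a strictly increasing bijection, and let $p_2^{-1}$ be its inverse. Theorem. Let $N\ge 2$ be real. In the round trip variant with $B=2$, the camel can penetrate at most $p_2^{-1}(N)$ miles and more than $p_2^{-1}(N)-\frac1{N-1}$ miles into the desert. The upper bound $p_2^{-1}(N)$ can be attained if $2\le N\le 4$ or $N=2^k$ for some integer $k\ge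 1$. If $4<N<8$, then the upper bound $p_2^{-1}(N)=\frac{N-4}4+2$ cannot be attained. The camel can penetrate exactly $\frac{N-4}6+2$ miles into the desert if $4\le N\le 6$, and exactly $\frac{N-5}3+2$ miles if $6\le N\le 8$ (that is, these are the maximal depths, and they are attained). -/

import Mathlib

namespace Camel

noncomputable section

/-- A situation in the desert `[0, ∞)`, whose border is position `0`. Bananas are indivisible. -/
structure State where
  /-- position of the camel -/
  pos : ℝ
  /-- banana fuel in the stomach of the camel -/
  stomach : ℝ
  /-- number of bananas on the back of the camel -/
  back : ℕ
  /-- positions of the bananas that lie on the ground, with multiplicity -/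
  ground : Multiset ℝ

/-- One action of a camel that can carry `B` bananas on its back. -/
inductive Step (B : ℕ) : State → State → Prop
  /-- Walk straight from `x` to `y`, at one banana unit of stomach fuel per mile. -/
  | walk (x y s : ℝ) (k : ℕ) (G : Multiset ℝ) (hy : 0 ≤ y) (hs : |y - x| ≤ s) :
      Step B ⟨x, s, k, G⟩ ⟨y, s - |y - x|, k, G⟩
  /-- Take a banana that lies at the position of the camel on the back. -/
  | load (x s : ℝ) (k : ℕ) (G : Multiset ℝ) (hk : k < B) :
      Step B ⟨x, s, k, x ::ₘ G⟩ ⟨x, s, k + 1, G⟩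
  /-- Lay down a banana from the back. -/
  | unload (x s : ℝ) (k : ℕ) (G : Multiset ℝ) :
      Step B ⟨x, s, k + 1, G⟩ ⟨x, s, k, x ::ₘ G⟩
  /-- Eat a banana that lies at the position of the camel. -/
  | eatGround (x s : ℝ) (k : ℕ) (G : Multiset ℝ) (hs : s ≤ 1) :
      Step B ⟨x, s, k, x ::ₘ G⟩ ⟨x, s + 1, k, G⟩
  /-- Eat a banana from the back. -/
  | eatBack (x s : ℝ) (k : ℕ) (G : Multiset ℝ) (hs : s ≤ 1) :
      Step B ⟨x, s, k + 1, G⟩ ⟨x, s + 1, k, G⟩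

/-- The situation at the beginning with `N ≥ 0` bananas: `⌊N⌋` bananas lie at the border, where
the camel is, and the camel has the remaining `N - ⌊N⌋` banana units in its stomach. -/
def start (N : ℝ) : State :=
  ⟨0, Int.fract N, 0, Multiset.replicate ⌊N⌋₊ 0⟩

/-- A finite sequence of actions. -/
def Reach (B : ℕ) : State → State → Prop :=
  Relation.ReflTransGen (Step B)

/-- The distances that the camel can penetrate into the desert in the round trip variant:
the camel gets to position `d` and returns to the border afterwards. -/
def roundTripDepths (B : ℕ) (N : ℝ) : Set ℝ :=
  {d | ∃ σ τ : State, Reach B (start N) σ ∧ σ.pos = d ∧ Reach B σ τ ∧ τ.pos = 0}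

/-- The function `p_B`, the linear interpolation of `(1 + 2/B) ^ x` between integers. -/
def p (B : ℕ) (x : ℝ) : ℝ :=
  (1 + 2 / (B : ℝ)) ^ ⌊x⌋ * (1 + 2 / (B : ℝ) * (x - ⌊x⌋))

/-- The inverse of `p_B`, on the positive reals. -/
def pInv (B : ℕ) : ℝ → ℝ :=
  Function.invFun (p B)

theorem p_strictMono (B : ℕ) (hB : 0 < B) : StrictMono (p B) := by
  intro x y hxy
  have hB' : (0 : ℝ) < 2 / (B : ℝ) := by positivity
  have hx0 := Int.floor_le x
  have hx1 := Int.lt_floor_add_one x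
  have hy0 := Int.floor_le y
  have ha : (0 : ℝ) < 1 + 2 / (B : ℝ) := by positivity
  unfold p
  rcases (Int.floor_mono hxy.le).eq_or_lt with h | h
  · rw [← h]
    have := mul_lt_mul_of_pos_left hxy hB'
    exact mul_lt_mul_of_pos_left (by linarith) (zpow_pos ha _)
  · calc (1 + 2 / (B : ℝ)) ^ ⌊x⌋ * (1 + 2 / (B : ℝ) * (x - ⌊x⌋))
        < (1 + 2 / (B : ℝ)) ^ ⌊x⌋ * (1 + 2 / (B : ℝ)) := by
          refine mul_lt_mul_of_pos_left ?_ (zpow_pos ha _)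
          nlinarith
      _ = (1 + 2 / (B : ℝ)) ^ (⌊x⌋ + 1) := by rw [zpow_add_one₀ ha.ne']
      _ ≤ (1 + 2 / (B : ℝ)) ^ ⌊y⌋ := zpow_le_zpow_right₀ (by linarith) (by omega)
      _ ≤ (1 + 2 / (B : ℝ)) ^ ⌊y⌋ * (1 + 2 / (B : ℝ) * (y - ⌊y⌋)) := by
          refine le_mul_of_one_le_right (zpow_pos ha _).le ?_
          nlinarith

theorem p_surj (B : ℕ) (hB : 0 < B) (N : ℝ) (hN : 0 < N) : ∃ x, p B x = N := by
  have hB' : (0 : ℝ) < 2 / (B : ℝ) := by positivity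
  have ha : (0 : ℝ) < 1 + 2 / (B : ℝ) := by positivity
  obtain ⟨n, h0, h1⟩ := exists_mem_Ico_zpow hN (by linarith : 1 < 1 + 2 / (B : ℝ))
  have hp := zpow_pos ha n
  rw [zpow_add_one₀ ha.ne'] at h1
  set c := (1 + 2 / (B : ℝ)) ^ n with hc
  have h2 : 1 ≤ N / c := by rwa [le_div_iff₀ hp, one_mul]
  have h3 : N / c < 1 + 2 / (B : ℝ) := by rwa [div_lt_iff₀ hp, mul_comm]
  have hfl : ⌊(n : ℝ) + (N / c - 1) / (2 / (B : ℝ))⌋ = n := by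
    rw [Int.floor_eq_iff]
    have h4 : 0 ≤ (N / c - 1) / (2 / (B : ℝ)) := div_nonneg (by linarith) hB'.le
    have h5 : (N / c - 1) / (2 / (B : ℝ)) < 1 := by
      rw [div_lt_one hB']; linarith
    constructor <;> linarith
  refine ⟨(n : ℝ) + (N / c - 1) / (2 / (B : ℝ)), ?_⟩
  unfold p
  rw [hfl, ← hc, add_sub_cancel_left, mul_div_cancel₀ _ hB'.ne', add_sub_cancel,
    mul_div_cancel₀ _ hp.ne']

theorem p_pInv (B : ℕ) (hB : 0 < B) (N : ℝ) (hN : 0 < N) : p B (pInv B N) = N :=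
  Function.invFun_eq (p_surj B hB N hN)

theorem pInv_p (B : ℕ) (hB : 0 < B) (x : ℝ) : pInv B (p B x) = x :=
  Function.leftInverse_invFun (p_strictMono B hB).injective x

end

end Camel

namespace Camel

/-- The physical constraints that all actions preserve. -/
structure Valid (B : ℕ) (σ : State) : Prop where
  pos_nonneg : 0 ≤ σ.pos
  stomach_nonneg : 0 ≤ σ.stomach
  stomach_le : σ.stomach ≤ 2
  back_le : σ.back ≤ B

theorem Valid.step {B : ℕ} {σ τ : State} (h : Valid B σ) (hs : Step B σ τ) : Valid B τ := by
  obtain ⟨h1, h2, h3, h4⟩ := h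
  cases hs <;> constructor <;> dsimp only at * <;> first | assumption | omega | skip
  · linarith
  · rename_i x y s k G hy hs
    linarith [abs_nonneg (y - x)]
  all_goals linarith

theorem valid_start (B : ℕ) (N : ℝ) : Valid B (start N) :=
  ⟨le_rfl, Int.fract_nonneg N, by simp only [start]; linarith [Int.fract_lt_one N],
    Nat.zero_le _⟩

/-- The total amount of banana fuel that is left. -/
noncomputable def State.fuel (σ : State) : ℝ :=
  σ.stomach + σ.back + Multiset.card σ.ground

theorem fuel_start {N : ℝ} (hN : 0 ≤ N) : (start N).fuel = N := by
  have h : ((⌊N⌋₊ : ℕ) : ℝ) = ((⌊N⌋ : ℤ) : ℝ) := natCast_floor_eq_intCast_floor hN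
  simp only [State.fuel, start, Multiset.card_replicate, Nat.cast_zero, add_zero, h]
  exact Int.fract_add_floor N

/-- The part of the desert between `x` and `x + 1` that lies before `p`, as a length. -/
noncomputable def ramp (x p : ℝ) : ℝ := max 0 (min 1 (p - x))

/-- The part of the desert beyond `x` that lies before `p`, as a length. -/
noncomputable def beyond (x p : ℝ) : ℝ := max 0 (p - x)

/-- The largest amount of fuel that can be consumed beyond a milestone, minus the transport of the
bananas eaten on the mile towards the milestone, starting at distance `1 - u` before the milestone
with `s` units in the stomach. -/
noncomputable def surplus (u s : ℝ) : ℝ := min (s - u) (max 0 (s - 2 + u))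

theorem ramp_nonneg (x p : ℝ) : 0 ≤ ramp x p := le_max_left _ _

theorem ramp_le_one (x p : ℝ) : ramp x p ≤ 1 := max_le zero_le_one (min_le_left _ _)

theorem ramp_of_le {x p : ℝ} (h : p ≤ x) : ramp x p = 0 := by
  unfold ramp
  exact max_eq_left ((min_le_right _ _).trans (by linarith))

theorem beyond_of_le {x p : ℝ} (h : p ≤ x) : beyond x p = 0 := max_eq_left (by linarith)

theorem surplus_zero {s : ℝ} (h0 : 0 ≤ s) (h2 : s ≤ 2) : surplus 0 s = 0 := by
  unfold surplus
  rw [max_eq_left (by linarith), min_eq_right (by linarith)]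

theorem surplus_one (s : ℝ) : surplus 1 s = s - 1 := by
  unfold surplus
  apply min_eq_left
  exact le_max_of_le_right (by linarith)

theorem surplus_mono {u s t : ℝ} (h : s ≤ t) : surplus u s ≤ surplus u t := by
  unfold surplus
  gcongr

theorem surplus_eat {u s : ℝ} (hu0 : 0 ≤ u) (hu1 : u ≤ 1) (hs0 : 0 ≤ s) (hs1 : s ≤ 1) :
    surplus u (s + 1) ≤ surplus u s + u := by
  unfold surplus
  rw [← min_add_add_right]
  refine le_min ?_ ?_
  · refine (min_le_right _ _).trans (max_le ?_ ?_) <;> linarith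
  · refine (min_le_right _ _).trans (max_le ?_ ?_)
    · have := le_max_left 0 (s - 2 + u)
      linarith
    · have := le_max_left 0 (s - 2 + u)
      linarith

theorem surplus_add_le (u δ s : ℝ) (hδ : 0 ≤ δ) : surplus (u + δ) (s - δ) ≤ surplus u s := by
  unfold surplus
  refine min_le_min (by linarith) (max_le_max le_rfl (by linarith))

theorem surplus_sub_le (u δ s : ℝ) (hδ : 0 ≤ δ) : surplus (u - δ) (s - δ) ≤ surplus u s := by
  unfold surplus
  refine min_le_min (by linarith) (max_le_max le_rfl (by linarith))

theorem ramp_eq (x p : ℝ) : ramp x p = beyond x p - beyond (x + 1) p := by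
  unfold ramp beyond
  grind

theorem ramp_mono (x : ℝ) {p q : ℝ} (h : p ≤ q) : ramp x p ≤ ramp x q := by
  unfold ramp
  gcongr

theorem beyond_mono (x : ℝ) {p q : ℝ} (h : p ≤ q) : beyond x p ≤ beyond x q := by
  unfold beyond
  gcongr

theorem beyond_sub_le (x : ℝ) {p q : ℝ} (h : p ≤ q) : beyond x q - beyond x p ≤ q - p := by
  unfold beyond
  grind

theorem ramp_eq_one {x p : ℝ} (h : 0 < beyond (x + 1) p) : ramp x p = 1 := by
  unfold ramp
  unfold beyond at h
  grind

theorem walk_surplus_out (x s : ℝ) {p q : ℝ} (h : p ≤ q) :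
    (beyond (x + 1) q - beyond (x + 1) p) + surplus (ramp x q) (s - (q - p)) ≤
      surplus (ramp x p) s := by
  have h1 := beyond_sub_le x h
  have h2 := ramp_mono x h
  have e1 := ramp_eq x p
  have e2 := ramp_eq x q
  rcases (beyond_mono (x + 1) h).eq_or_lt with hb | hb
  · have := surplus_add_le (ramp x p) (ramp x q - ramp x p) s (by linarith)
    rw [add_sub_cancel] at this
    have h3 := surplus_mono (u := ramp x q)
      (show s - (q - p) ≤ s - (ramp x q - ramp x p) by linarith)
    linarith
  · have h4 : 0 ≤ beyond (x + 1) p := le_max_left _ _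
    have hq := ramp_eq_one (h4.trans_lt hb)
    have h5 : surplus 1 (s - (1 - ramp x p)) ≤ surplus (ramp x p) s := by
      have := surplus_add_le (ramp x p) (1 - ramp x p) s (by linarith [ramp_le_one x p])
      rwa [add_sub_cancel] at this
    rw [hq, surplus_one]
    rw [surplus_one] at h5
    linarith

theorem walk_surplus_in (x s : ℝ) {p q : ℝ} (h : q ≤ p) :
    (beyond (x + 1) p - beyond (x + 1) q) + surplus (ramp x q) (s - (p - q)) ≤
      surplus (ramp x p) s := by
  have h1 := beyond_sub_le x h
  have h2 := ramp_mono x h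
  have e1 := ramp_eq x p
  have e2 := ramp_eq x q
  rcases (beyond_mono (x + 1) h).eq_or_lt with hb | hb
  · have := surplus_sub_le (ramp x p) (ramp x p - ramp x q) s (by linarith)
    rw [sub_sub_cancel] at this
    have h3 := surplus_mono (u := ramp x q)
      (show s - (p - q) ≤ s - (ramp x p - ramp x q) by linarith)
    linarith
  · have h4 : 0 ≤ beyond (x + 1) q := le_max_left _ _
    have hq := ramp_eq_one (h4.trans_lt hb)
    rw [hq, surplus_one]
    have : surplus (ramp x q) (s - (p - q)) ≤ s - (p - q) - ramp x q := min_le_left _ _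
    linarith

/-- The banana miles that have been made on the mile after `x` by the bananas not yet eaten. -/
noncomputable def transport (x : ℝ) (σ : State) : ℝ :=
  (σ.ground.map (ramp x)).sum + σ.back * ramp x σ.pos

theorem transport_nonneg (x : ℝ) (σ : State) : 0 ≤ transport x σ := by
  refine add_nonneg (Multiset.sum_nonneg ?_) (mul_nonneg (Nat.cast_nonneg _) (ramp_nonneg _ _))
  intro r hr
  obtain ⟨g, -, rfl⟩ := Multiset.mem_map.1 hr
  exact ramp_nonneg _ _

/-- `c x` is a possible amount of fuel that has been consumed beyond `x`. -/
structure Consumption (N : ℝ) (σ : State) (c : ℝ → ℝ) : Prop where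
  total : c 0 + σ.fuel = N
  beyond_le : ∀ x, 0 ≤ x → beyond x σ.pos ≤ c x
  balance : ∀ x, 0 ≤ x → 2 * c (x + 1) + transport x σ + surplus (ramp x σ.pos) σ.stomach ≤
    c x + ramp x σ.pos

/-- The consumption of an action beyond `x`. -/
noncomputable def stepCost (σ τ : State) (x : ℝ) : ℝ := |beyond x τ.pos - beyond x σ.pos|

theorem Consumption.step {N : ℝ} {σ τ : State} {c : ℝ → ℝ} (hv : Valid 2 σ)
    (hc : Consumption N σ c) (hs : Step 2 σ τ) :
    Consumption N τ (fun x => c x + stepCost σ τ x) := by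
  obtain ⟨h1, h2, h3, h4⟩ := hv
  obtain ⟨ht, hb, hbal⟩ := hc
  cases hs with
  | walk x y s k G hy hs =>
    dsimp only at *
    have hk : (k : ℝ) ≤ 2 := by exact_mod_cast h4
    have hk0 : (0 : ℝ) ≤ k := Nat.cast_nonneg k
    refine ⟨?_, fun t h0 => ?_, fun t h0 => ?_⟩
    · simp only [State.fuel, stepCost, beyond, sub_zero, max_eq_right h1, max_eq_right hy] at ht ⊢
      linarith
    · have := hb t h0
      have := le_abs_self (beyond t y - beyond t x)
      simp only [stepCost]
      linarith
    · have hbt := hbal t h0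
      simp only [transport, stepCost] at hbt ⊢
      have e1 := ramp_eq t x
      have e2 := ramp_eq t y
      rcases le_total x y with h | h
      · have := walk_surplus_out t s h
        have h5 := ramp_mono t h
        rw [abs_of_nonneg (sub_nonneg.2 (beyond_mono (t + 1) h)),
          abs_of_nonneg (sub_nonneg.2 (beyond_mono t h)), abs_of_nonneg (sub_nonneg.2 h)]
        nlinarith
      · have := walk_surplus_in t s h
        have h5 := ramp_mono t h
        rw [abs_of_nonpos (sub_nonpos.2 (beyond_mono (t + 1) h)),
          abs_of_nonpos (sub_nonpos.2 (beyond_mono t h)), abs_of_nonpos (sub_nonpos.2 h)]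
        simp only [neg_sub]
        nlinarith
  | load x s k G hk =>
    refine ⟨?_, fun t h0 => ?_, fun t h0 => ?_⟩
    · simp only [State.fuel, stepCost, sub_self, abs_zero, Multiset.card_cons] at ht ⊢
      push_cast at ht ⊢
      linarith
    · simpa [stepCost] using hb t h0
    · have := hbal t h0
      simp only [transport, stepCost, sub_self, abs_zero, Multiset.map_cons,
        Multiset.sum_cons] at this ⊢
      push_cast at this ⊢
      linarith
  | unload x s k G =>
    refine ⟨?_, fun t h0 => ?_, fun t h0 => ?_⟩
    · simp only [State.fuel, stepCost, sub_self, abs_zero, Multiset.card_cons] at ht ⊢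
      push_cast at ht ⊢
      linarith
    · simpa [stepCost] using hb t h0
    · have := hbal t h0
      simp only [transport, stepCost, sub_self, abs_zero, Multiset.map_cons,
        Multiset.sum_cons] at this ⊢
      push_cast at this ⊢
      linarith
  | eatGround x s k G hs =>
    refine ⟨?_, fun t h0 => ?_, fun t h0 => ?_⟩
    · simp only [State.fuel, stepCost, sub_self, abs_zero, Multiset.card_cons] at ht ⊢
      push_cast at ht ⊢
      linarith
    · simpa [stepCost] using hb t h0
    · have := hbal t h0
      have := surplus_eat (ramp_nonneg t x) (ramp_le_one t x) h2 hs
      simp only [transport, stepCost, sub_self, abs_zero, Multiset.map_cons,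
        Multiset.sum_cons] at *
      linarith
  | eatBack x s k G hs =>
    refine ⟨?_, fun t h0 => ?_, fun t h0 => ?_⟩
    · simp only [State.fuel, stepCost, sub_self, abs_zero] at ht ⊢
      push_cast at ht ⊢
      linarith
    · simpa [stepCost] using hb t h0
    · have := hbal t h0
      have := surplus_eat (ramp_nonneg t x) (ramp_le_one t x) h2 hs
      simp only [transport, stepCost, sub_self, abs_zero] at *
      push_cast at *
      linarith

theorem consumption_start {N : ℝ} (hN : 0 ≤ N) : Consumption N (start N) 0 := by
  have hv := valid_start 2 N
  have h : (start N).pos = 0 := rfl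
  refine ⟨by simpa using fuel_start hN, fun x hx => ?_, fun x hx => ?_⟩
  · rw [h, beyond_of_le hx]
    exact le_rfl
  · rw [h, ramp_of_le hx, surplus_zero hv.stomach_nonneg hv.stomach_le]
    simp [transport, start, ramp_of_le hx]

theorem exists_consumption_of_reach {N : ℝ} {σ τ : State} (hv : Valid 2 σ) (h : Reach 2 σ τ)
    {c : ℝ → ℝ} (hc : Consumption N σ c) (d : ℝ)
    (hd : ∀ x, 0 ≤ x → 2 * beyond x d ≤ c x + beyond x σ.pos) :
    Valid 2 τ ∧ ∃ c', Consumption N τ c' ∧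
      ∀ x, 0 ≤ x → 2 * beyond x d ≤ c' x + beyond x τ.pos := by
  induction h with
  | refl => exact ⟨hv, c, hc, hd⟩
  | @tail ρ τ _ hs ih =>
    obtain ⟨hv', c', hc', hd'⟩ := ih
    refine ⟨hv'.step hs, _, hc'.step hv' hs, fun x hx => ?_⟩
    have := hd' x hx
    have := neg_abs_le (beyond x τ.pos - beyond x ρ.pos)
    simp only [stepCost]
    linarith

theorem exists_consumption_of_mem_roundTripDepths {N d : ℝ} (hN : 0 ≤ N)
    (h : d ∈ roundTripDepths 2 N) :
    ∃ c : ℝ → ℝ, c 0 ≤ N ∧ (∀ x, 0 ≤ x → 2 * c (x + 1) ≤ c x) ∧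
      ∀ x, 0 ≤ x → 2 * (d - x) ≤ c x := by
  obtain ⟨σ, τ, h1, rfl, h2, h3⟩ := h
  obtain ⟨hv, c, hc, -⟩ := exists_consumption_of_reach (valid_start 2 N) h1 (consumption_start hN) 0
    (fun x hx => by
      rw [beyond_of_le hx, beyond_of_le (show (start N).pos ≤ x from hx)]
      simp)
  obtain ⟨hv', c', hc', hd'⟩ := exists_consumption_of_reach hv h2 hc σ.pos
    (fun x hx => by linarith [hc.beyond_le x hx])
  refine ⟨c', ?_, fun x hx => ?_, fun x hx => ?_⟩
  · have := hc'.total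
    have h4 : 0 ≤ τ.fuel := by
      have := hv'.stomach_nonneg
      unfold State.fuel
      positivity
    linarith
  · have h4 := hc'.balance x hx
    rw [h3, ramp_of_le hx, surplus_zero hv'.stomach_nonneg hv'.stomach_le] at h4
    linarith [transport_nonneg x τ]
  · have h4 := hd' x hx
    rw [h3, beyond_of_le hx] at h4
    have h5 : σ.pos - x ≤ beyond x σ.pos := le_max_right _ _
    linarith

theorem p_two_add (n : ℤ) {f : ℝ} (h0 : 0 ≤ f) (h1 : f < 1) :
    p 2 (n + f) = 2 ^ n * (1 + f) := by
  have hf : ⌊(n : ℝ) + f⌋ = n := by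
    rw [Int.floor_eq_iff]
    constructor <;> linarith
  unfold p
  rw [hf]
  norm_num

theorem le_pInv_iff {N d : ℝ} (hN : 0 < N) : d ≤ pInv 2 N ↔ p 2 d ≤ N := by
  rw [← (p_strictMono 2 two_pos).le_iff_le, p_pInv 2 two_pos N hN]

theorem pInv_mem_upperBounds {N : ℝ} (hN : 2 ≤ N) :
    pInv 2 N ∈ upperBounds (roundTripDepths 2 N) := by
  intro d hd
  rw [le_pInv_iff (by linarith)]
  rcases lt_or_ge d 1 with h1 | h1
  · have := p_strictMono 2 two_pos h1
    have h2 := p_two_add 1 le_rfl zero_lt_one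
    norm_num at h2
    linarith
  obtain ⟨c, hc0, hc, hcd⟩ := exists_consumption_of_mem_roundTripDepths (by linarith) hd
  have hpow : ∀ n : ℕ, (2 : ℝ) ^ n * c n ≤ c 0 := by
    intro n
    induction n with
    | zero => simp
    | succ n ih =>
      refine le_trans ?_ ih
      have := hc n (Nat.cast_nonneg n)
      push_cast
      rw [pow_succ, mul_assoc]
      gcongr
  obtain ⟨n, hn⟩ : ∃ n : ℕ, ⌊d⌋₊ = n + 1 := Nat.exists_eq_succ_of_ne_zero (by
    rw [← Nat.pos_iff_ne_zero, Nat.floor_pos]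
    exact h1)
  have hf0 := Nat.floor_le (show 0 ≤ d by linarith)
  have hf1 := Nat.lt_floor_add_one d
  rw [hn] at hf0 hf1
  push_cast at hf0 hf1
  have h2 := p_two_add (n + 1 : ℕ) (f := d - (n + 1)) (by linarith) (by linarith)
  push_cast at h2
  rw [add_sub_cancel] at h2
  rw [h2]
  refine le_trans ?_ ((hpow n).trans hc0)
  have h3 := hcd n (Nat.cast_nonneg n)
  rw [zpow_add_one₀ two_ne_zero, zpow_natCast, mul_assoc]
  gcongr
  linarith

/-- The stages of a trip from the border to depth `d` and back, in terms of the farthest position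
`m` reached so far, and the farthest position `z` reached before the most recent moment at a
position at most `z`. Position `r` has been reached. -/
inductive Stage (N d r : ℝ) (σ : State) : Prop
  | near (z : ℝ) (hr : r ≤ z) (hz : z < d) (hp : σ.pos ≤ z) (hG : ∀ g ∈ σ.ground, g ≤ z)
      (hc : 2 * z + σ.pos ≤ N - σ.fuel)
  | far (z m : ℝ) (hr : r ≤ m) (hp : z < σ.pos) (hm : σ.pos ≤ m) (hG : ∀ g ∈ σ.ground, g ≤ m)
      (hc : 2 * z + 2 * m - σ.pos ≤ N - σ.fuel)
      (hf : σ.stomach + σ.back + σ.ground.countP (z < ·) + (2 * m - σ.pos - z) ≤ 4)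
  | back (z : ℝ) (hz : d - 2 ≤ z) (hc : z + 2 * d + |z - σ.pos| ≤ N - σ.fuel)
      (hs : σ.stomach + |z - σ.pos| ≤ 2 * z - 2 * (d - 2))
  | fed (z : ℝ) (hz : d - 2 ≤ z) (hc : z + 2 * d + 1 ≤ N - σ.fuel + σ.stomach)

theorem Stage.step {N d r : ℝ} {σ τ : State} (hv : Valid 2 σ) (h : Stage N d r σ)
    (hs : Step 2 σ τ) : Stage N d r τ := by
  have hv' := hv.step hs
  obtain ⟨h1, h2, h3, h4⟩ := hv
  cases hs with
  | walk x y s k G hy hs =>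
    have h2' := hv'.stomach_nonneg
    dsimp only at *
    have hk : (k : ℝ) ≤ 2 := by exact_mod_cast h4
    cases h with
    | near z hr hz hp hG hc =>
      dsimp only [State.fuel] at *
      rcases le_or_gt y z with hyz | hyz
      · refine .near z hr hz hyz hG ?_
        dsimp only [State.fuel]
        linarith [le_abs_self (y - x)]
      · have h0 : G.countP (z < ·) = 0 := by
          rw [Multiset.countP_eq_zero]
          exact fun g hg => not_lt.2 (hG g hg)
        have := le_abs_self (y - x)
        refine .far z y (by linarith) hyz le_rfl (fun g hg => (hG g hg).trans hyz.le) ?_ ?_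
        · dsimp only [State.fuel]
          linarith
        · dsimp only
          rw [h0, Nat.cast_zero]
          linarith
    | far z m hr hp hm hG hc hf =>
      dsimp only [State.fuel] at *
      rcases le_or_gt y z with hyz | hyz
      · have habs : |y - x| = x - y := by rw [abs_of_nonpos (by linarith), neg_sub]
        have h5 : (0 : ℝ) ≤ k := Nat.cast_nonneg k
        have h6 : (0 : ℝ) ≤ G.countP (z < ·) := Nat.cast_nonneg _
        rw [habs] at h2' ⊢
        rcases lt_or_ge m d with hmd | hmd
        · refine .near m hr hmd (by dsimp only; linarith) hG ?_
          dsimp only [State.fuel]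
          linarith
        · have habs' : |z - y| = z - y := abs_of_nonneg (by linarith)
          refine .back z (by linarith) ?_ ?_ <;> dsimp only [State.fuel] <;> rw [habs'] <;> linarith
      · rcases le_total y m with hym | hym
        · refine .far z m hr hyz hym hG ?_ ?_ <;> dsimp only [State.fuel] <;>
            linarith [neg_abs_le (y - x)]
        · have := le_abs_self (y - x)
          refine .far z y (by linarith) hyz le_rfl (fun g hg => (hG g hg).trans hym) ?_ ?_ <;>
            dsimp only [State.fuel] <;> linarith
    | back z hz hc hs =>
      have := abs_sub_le z x y
      have := abs_sub_comm x y
      refine .back z hz ?_ ?_ <;> dsimp only [State.fuel] at * <;> linarith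
    | fed z hz hc =>
      refine .fed z hz ?_
      dsimp only [State.fuel] at *
      linarith
  | load x s k G hk =>
    cases h with
    | near z hr hz hp hG hc =>
      refine .near z hr hz hp (fun g hg => hG g (Multiset.mem_cons_of_mem hg)) ?_
      simp only [State.fuel, Multiset.card_cons] at *
      push_cast at *
      linarith
    | far z m hr hp hm hG hc hf =>
      refine .far z m hr hp hm (fun g hg => hG g (Multiset.mem_cons_of_mem hg)) ?_ ?_ <;>
      simp only [State.fuel, Multiset.card_cons, Multiset.countP_cons_of_pos _ hp] at * <;>
      push_cast at * <;> linarith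
    | back z hz hc hs =>
      refine .back z hz ?_ hs
      simp only [State.fuel, Multiset.card_cons] at *
      push_cast at *
      linarith
    | fed z hz hc =>
      refine .fed z hz ?_
      simp only [State.fuel, Multiset.card_cons] at *
      push_cast at *
      linarith
  | unload x s k G =>
    cases h with
    | near z hr hz hp hG hc =>
      refine .near z hr hz hp (Multiset.forall_mem_cons.2 ⟨hp, hG⟩) ?_
      simp only [State.fuel, Multiset.card_cons] at *
      push_cast at *
      linarith
    | far z m hr hp hm hG hc hf =>
      refine .far z m hr hp hm (Multiset.forall_mem_cons.2 ⟨hm, hG⟩) ?_ ?_ <;>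
      simp only [State.fuel, Multiset.card_cons, Multiset.countP_cons_of_pos _ hp] at * <;>
      push_cast at * <;> linarith
    | back z hz hc hs =>
      refine .back z hz ?_ hs
      simp only [State.fuel, Multiset.card_cons] at *
      push_cast at *
      linarith
    | fed z hz hc =>
      refine .fed z hz ?_
      simp only [State.fuel, Multiset.card_cons] at *
      push_cast at *
      linarith
  | eatGround x s k G hs =>
    cases h with
    | near z hr hz hp hG hc =>
      refine .near z hr hz hp (fun g hg => hG g (Multiset.mem_cons_of_mem hg)) ?_
      simp only [State.fuel, Multiset.card_cons] at *
      push_cast at *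
      linarith
    | far z m hr hp hm hG hc hf =>
      refine .far z m hr hp hm (fun g hg => hG g (Multiset.mem_cons_of_mem hg)) ?_ ?_ <;>
      simp only [State.fuel, Multiset.card_cons, Multiset.countP_cons_of_pos _ hp] at * <;>
      push_cast at * <;> linarith
    | back z hz hc hs' =>
      refine .fed z hz ?_
      have := abs_nonneg (z - x)
      simp only [State.fuel, Multiset.card_cons] at *
      push_cast at *
      linarith
    | fed z hz hc =>
      refine .fed z hz ?_
      simp only [State.fuel, Multiset.card_cons] at *
      push_cast at *
      linarith
  | eatBack x s k G hs =>
    cases h with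
    | near z hr hz hp hG hc =>
      refine .near z hr hz hp hG ?_
      simp only [State.fuel] at *
      push_cast at *
      linarith
    | far z m hr hp hm hG hc hf =>
      refine .far z m hr hp hm hG ?_ ?_ <;> simp only [State.fuel] at * <;>
      push_cast at * <;> linarith
    | back z hz hc hs' =>
      refine .fed z hz ?_
      have := abs_nonneg (z - x)
      simp only [State.fuel] at *
      push_cast at *
      linarith
    | fed z hz hc =>
      refine .fed z hz ?_
      simp only [State.fuel] at *
      push_cast at *
      linarith

theorem Stage.reach {N d r : ℝ} {σ τ : State} (hv : Valid 2 σ) (h : Stage N d r σ)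
    (hs : Reach 2 σ τ) : Valid 2 τ ∧ Stage N d r τ := by
  induction hs with
  | refl => exact ⟨hv, h⟩
  | tail _ hs ih => exact ⟨ih.1.step hs, ih.2.step ih.1 hs⟩

theorem le_or_le_of_mem_roundTripDepths {N d : ℝ} (hN : 0 ≤ N) (hd : 0 < d)
    (h : d ∈ roundTripDepths 2 N) : 4 + 6 * (d - 2) ≤ N ∨ 5 + 3 * (d - 2) ≤ N := by
  obtain ⟨σ, τ, h1, hσ, h2, hτ⟩ := h
  have hstart : Stage N d 0 (start N) := by
    refine .near 0 le_rfl hd le_rfl (fun g hg => (Multiset.eq_of_mem_replicate hg).le) ?_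
    rw [fuel_start hN, show (start N).pos = 0 from rfl]
    simp
  obtain ⟨hv, hst⟩ := hstart.reach (valid_start 2 N) h1
  have hst' : Stage N d d σ := by
    cases hst with
    | near z hr hz hp hG hc => linarith
    | far z m hr hp hm hG hc hf => exact .far z m (hσ ▸ hm) hp hm hG hc hf
    | back z hz hc hs => exact .back z hz hc hs
    | fed z hz hc => exact .fed z hz hc
  obtain ⟨hv', hst''⟩ := hst'.reach hv h2
  have hs := hv'.stomach_nonneg
  have hf : τ.stomach ≤ τ.fuel := by
    unfold State.fuel
    have : (0 : ℝ) ≤ τ.back + Multiset.card τ.ground := by positivity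
    linarith
  cases hst'' with
  | near z hr hz hp hG hc => linarith
  | far z m hr hp hm hG hc hf' =>
    have h5 : (0 : ℝ) ≤ τ.back := Nat.cast_nonneg _
    have h6 : (0 : ℝ) ≤ τ.ground.countP (z < ·) := Nat.cast_nonneg _
    rw [hτ] at *
    left
    linarith
  | back z hz hc hs' =>
    rw [hτ, sub_zero] at *
    have := le_abs_self z
    left
    linarith
  | fed z hz hc =>
    right
    linarith

theorem reach_walk {B : ℕ} {x y s s' : ℝ} {k : ℕ} {G : Multiset ℝ} (hy : 0 ≤ y) (hs' : 0 ≤ s')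
    (h : s' = s - |y - x|) : Reach B ⟨x, s, k, G⟩ ⟨y, s', k, G⟩ := by
  subst h
  exact .single (.walk x y s k G hy (by linarith))

theorem reach_out {B : ℕ} {x y s s' : ℝ} {k : ℕ} {G : Multiset ℝ} (hy : 0 ≤ y) (hxy : x ≤ y)
    (hs' : 0 ≤ s') (h : s' = s - (y - x)) : Reach B ⟨x, s, k, G⟩ ⟨y, s', k, G⟩ :=
  reach_walk hy hs' (by rw [h, abs_of_nonneg (by linarith)])

theorem reach_in {B : ℕ} {x y s s' : ℝ} {k : ℕ} {G : Multiset ℝ} (hy : 0 ≤ y) (hxy : y ≤ x)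
    (hs' : 0 ≤ s') (h : s' = s - (x - y)) : Reach B ⟨x, s, k, G⟩ ⟨y, s', k, G⟩ :=
  reach_walk hy hs' (by rw [h, abs_of_nonpos (by linarith), neg_sub])

theorem reach_eat {B : ℕ} {x s s' : ℝ} {k : ℕ} {G G' : Multiset ℝ} (hs : s ≤ 1)
    (h : s' = s + 1) (hG : G = {x} + G') : Reach B ⟨x, s, k, G⟩ ⟨x, s', k, G'⟩ := by
  subst h hG
  exact .single (.eatGround x s k G' hs)

theorem reach_eatBack {B : ℕ} {x s s' : ℝ} {k : ℕ} {G : Multiset ℝ} (hs : s ≤ 1)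
    (h : s' = s + 1) : Reach B ⟨x, s, k + 1, G⟩ ⟨x, s', k, G⟩ := by
  subst h
  exact .single (.eatBack x s k G hs)

theorem reach_load {B : ℕ} {x s : ℝ} {k : ℕ} {G G' : Multiset ℝ} (hk : k < B)
    (hG : G = {x} + G') : Reach B ⟨x, s, k, G⟩ ⟨x, s, k + 1, G'⟩ := by
  subst hG
  exact .single (.load x s k G' hk)

theorem reach_unload {B : ℕ} {x s : ℝ} {k : ℕ} {G G' : Multiset ℝ}
    (hG : G' = {x} + G) : Reach B ⟨x, s, k + 1, G⟩ ⟨x, s, k, G'⟩ := by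
  subst hG
  exact .single (.unload x s k G)

theorem reach_load_two {x s : ℝ} {G G' : Multiset ℝ} (hG : G = 2 • {x} + G') :
    Reach 2 ⟨x, s, 0, G⟩ ⟨x, s, 2, G'⟩ :=
  (reach_load (G' := {x} + G') two_pos (by rw [hG]; module)).trans
    (reach_load one_lt_two rfl)

theorem reach_unload_two {x s : ℝ} {G G' : Multiset ℝ} (hG : G' = 2 • {x} + G) :
    Reach 2 ⟨x, s, 2, G⟩ ⟨x, s, 0, G'⟩ :=
  (reach_unload rfl).trans (reach_unload (by rw [hG]; module))

/-- Carry two bananas from `x` to `y`. -/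
theorem reach_carry {x y s s' : ℝ} {G G₁ G₂ : Multiset ℝ} (hy : 0 ≤ y) (hxy : x ≤ y)
    (hs' : 0 ≤ s') (h : s' = s - (y - x)) (h1 : G₁ = 2 • {x} + G) (h2 : G₂ = 2 • {y} + G) :
    Reach 2 ⟨x, s, 0, G₁⟩ ⟨y, s', 0, G₂⟩ :=
  ((reach_load_two h1).trans (reach_out hy hxy hs' h)).trans (reach_unload_two h2)

theorem exists_reach_eat (B : ℕ) (x : ℝ) (G : Multiset ℝ) (e : ℕ) :
    ∀ s : ℝ, s ≤ 2 → ∃ (e' : ℕ) (s' : ℝ), s' + e' = s + e ∧ s' ≤ 2 ∧ s ≤ s' ∧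
      (e' = 0 ∨ 1 < s') ∧ Reach B ⟨x, s, 0, e • {x} + G⟩ ⟨x, s', 0, e' • {x} + G⟩ := by
  induction e with
  | zero => exact fun s hs => ⟨0, s, rfl, hs, le_rfl, .inl rfl, .refl⟩
  | succ e ih =>
    intro s hs
    rcases lt_or_ge 1 s with h1 | h1
    · exact ⟨e + 1, s, rfl, hs, le_rfl, .inr h1, .refl⟩
    · obtain ⟨e', s', h2, h3, h4, h5, h6⟩ := ih (s + 1) (by linarith)
      refine ⟨e', s', by push_cast; linarith, h3, by linarith, h5, ?_⟩
      exact (reach_eat h1 rfl (by module)).trans h6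

/-- Transport of `2 * r` bananas over at most a mile: without delay, or when the last two bananas
that left the border have only been brought to `z`. -/
theorem reach_transport {x t : ℝ} (hx0 : 0 ≤ x) (hx1 : x ≤ 1) (ht0 : 0 ≤ t) (ht1 : t ≤ 1) (r : ℕ) :
    (∀ (s : ℝ) (e : ℕ) (G : Multiset ℝ), 0 ≤ s → s ≤ 2 → s + e = t + (2 * r + 1) * x →
      Reach 2 ⟨0, s, 0, (2 * (r + 1) + e) • {0} + G⟩ ⟨x, t, 0, (2 * (r + 1)) • {x} + G⟩) ∧
    (∀ (z : ℝ) (e : ℕ) (G : Multiset ℝ), 1 / 2 < z → z ≤ x →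
      e = t + (2 * r + 1) * x + 2 * (x - z) →
      Reach 2 ⟨0, 0, 0, (2 * (r + 1) + e) • {0} + (2 • {z} + G)⟩
        ⟨x, t, 0, (2 * (r + 2)) • {x} + G⟩) := by
  induction r with
  | zero =>
    constructor
    · intro s e G hs0 hs2 hse
      obtain ⟨e', s', h1, h2, h3, h4, h5⟩ := exists_reach_eat 2 0 (2 • {0} + G) e s hs2
      push_cast at hse
      have he' : e' = 0 := by
        rcases h4 with h4 | h4
        · exact h4
        · by_contra h0
          have : (1 : ℝ) ≤ e' := by exact_mod_cast Nat.one_le_iff_ne_zero.2 h0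
          linarith
      subst he'
      push_cast at h1
      rw [show (2 * (0 + 1) + e) • {0} + G = e • {0} + (2 • {0} + G) by module]
      exact h5.trans (reach_carry (G := G) hx0 hx0 ht0 (by linarith) (by module) (by module))
    · intro z e G hz hzx he
      push_cast at he
      obtain ⟨e', s', h1, h2, h3, h4, h5⟩ :=
        exists_reach_eat 2 0 (2 • {0} + (2 • {z} + G)) e 0 zero_le_two
      have he2 : e < 3 := by
        have : (e : ℝ) < (3 : ℕ) := by push_cast; linarith
        exact_mod_cast this
      have he1 : (e : ℝ) ≤ 2 := by exact_mod_cast Nat.le_of_lt_succ he2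
      have he' : e' = 0 := by
        rcases h4 with h4 | h4
        · exact h4
        · have : (e' : ℝ) < (1 : ℕ) := by push_cast; linarith
          exact Nat.lt_one_iff.1 (by exact_mod_cast this)
      subst he'
      push_cast at h1
      rw [show (2 * (0 + 1) + e) • {0} + (2 • {z} + G) = e • {0} + (2 • {0} + (2 • {z} + G)) by
        module]
      refine h5.trans ?_
      refine (reach_carry (y := x) (s' := t + 2 * (x - z)) (G := 2 • {z} + G)
        (G₂ := 2 • {z} + (2 • {x} + G)) hx0 hx0 (by linarith) (by linarith)
        (by module) (by module)).trans ?_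
      refine (reach_in (y := z) (s' := t + (x - z)) (by linarith) hzx (by linarith)
        (by ring)).trans ?_
      exact reach_carry (G := 2 • {x} + G) hx0 hzx ht0 (by ring) rfl (by module)
  | succ r ih =>
    obtain ⟨ih1, ih2⟩ := ih
    have hrx : 0 ≤ r * x := by positivity
    constructor
    · intro s e G hs0 hs2 hse
      push_cast at hse
      obtain ⟨e', s', h1, h2, h3, h4, h5⟩ :=
        exists_reach_eat 2 0 ((2 * (r + 2)) • {0} + G) e s hs2
      rw [show (2 * (r + 1 + 1) + e) • {0} + G = e • {0} + ((2 * (r + 2)) • {0} + G) by module]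
      refine h5.trans ?_
      rcases le_or_gt (2 * x) s' with hs' | hs'
      · refine (reach_carry (y := x) (s' := s' - x) (G := (2 * (r + 1) + e') • {0} + G)
          (G₂ := (2 * (r + 1) + e') • {0} + (2 • {x} + G)) hx0 hx0 (by linarith) (by ring)
          (by module) (by module)).trans ?_
        refine (reach_in (y := 0) (s' := s' - 2 * x) le_rfl hx0 (by linarith) (by ring)).trans ?_
        rw [show (2 * (r + 1 + 1)) • {x} + G = (2 * (r + 1)) • {x} + (2 • {x} + G) by module]
        exact ih1 _ _ _ (by linarith) (by linarith) (by linarith)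
      · have hs1 : 1 < s' := by
          rcases h4 with h4 | h4
          · subst h4
            push_cast at h1
            linarith
          · exact h4
        refine (reach_carry (y := s' / 2) (s' := s' / 2) (G := (2 * (r + 1) + e') • {0} + G)
          (G₂ := (2 * (r + 1) + e') • {0} + (2 • {s' / 2} + G)) (by linarith) (by linarith)
          (by linarith) (by ring) (by module) (by module)).trans ?_
        refine (reach_in (y := 0) (s' := 0) le_rfl (by linarith) le_rfl (by ring)).trans ?_
        exact ih2 _ _ _ (by linarith) (by linarith) (by linarith)
    · intro z e G hz hzx he
      push_cast at he
      have he2 : 1 < e := by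
        have : ((1 : ℕ) : ℝ) < e := by push_cast; linarith
        exact_mod_cast this
      obtain ⟨e, rfl⟩ := Nat.exists_eq_add_of_le' he2
      push_cast at he
      refine (reach_eat (s' := 1) (G' := (2 * (r + 2) + e + 1) • {0} + (2 • {z} + G)) zero_le_one
        (by ring) (by module)).trans ?_
      refine (reach_eat (s' := 2) (G' := (2 * (r + 2) + e) • {0} + (2 • {z} + G)) le_rfl
        (by ring) (by module)).trans ?_
      refine (reach_carry (y := x) (s' := 2 - x) (G := (2 * (r + 1) + e) • {0} + (2 • {z} + G))
        (G₂ := 2 • {z} + ((2 * (r + 1) + e) • {0} + (2 • {x} + G))) hx0 hx0 (by linarith)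
        (by ring) (by module) (by module)).trans ?_
      refine (reach_in (y := z) (s' := 2 - 2 * x + z) (by linarith) hzx (by linarith)
        (by ring)).trans ?_
      rcases le_or_gt (2 * x + 2 * (x - z)) 2 with h | h
      · refine (reach_carry (y := x) (s' := 2 - 3 * x + 2 * z)
          (G := (2 * (r + 1) + e) • {0} + (2 • {x} + G))
          (G₂ := (2 * (r + 1) + e) • {0} + (4 • {x} + G)) hx0 hzx (by linarith)
          (by ring) (by module) (by module)).trans ?_
        refine (reach_in (y := 0) (s' := 2 - 4 * x + 2 * z) le_rfl hx0 (by linarith)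
          (by ring)).trans ?_
        rw [show (2 * (r + 1 + 2)) • {x} + G = (2 * (r + 1)) • {x} + (4 • {x} + G) by module]
        exact ih1 _ _ _ (by linarith) (by linarith) (by linarith)
      · refine (reach_carry (y := z + (1 - x)) (s' := 1 - x + z)
          (G := (2 * (r + 1) + e) • {0} + (2 • {x} + G))
          (G₂ := (2 * (r + 1) + e) • {0} + (2 • {z + (1 - x)} + (2 • {x} + G)))
          (by linarith) (by linarith) (by linarith)
          (by ring) (by module) (by module)).trans ?_
        refine (reach_in (y := 0) (s' := 0) le_rfl (by linarith) le_rfl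
          (by ring)).trans ?_
        rw [show (2 * (r + 1 + 2)) • {x} + G = (2 * (r + 2)) • {x} + (2 • {x} + G) by module]
        exact ih2 _ _ _ (by linarith) (by linarith) (by linarith)

/-- Round trips of two miles bring `2 * r` bananas one mile further. -/
theorem reach_shuttle {y : ℝ} (hy : 0 ≤ y) (r : ℕ) (G : Multiset ℝ) :
    Reach 2 ⟨y, 1, 0, (4 * r) • {y} + G⟩ ⟨y, 1, 0, (2 * r) • {y + 1} + G⟩ := by
  induction r generalizing G with
  | zero => simpa using .refl
  | succ r ih =>
    refine (reach_eat (s' := 2) (G' := (4 * r + 3) • {y} + G) le_rfl (by ring) (by module)).trans ?_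
    refine (reach_carry (y := y + 1) (s' := 1) (G := (4 * r + 1) • {y} + G)
      (G₂ := {y} + ((4 * r) • {y} + (2 • {y + 1} + G)))
      (by linarith) (by linarith) zero_le_one (by ring) (by module) (by module)).trans ?_
    refine (reach_in (y := y) (s' := 0) hy (by linarith) le_rfl (by ring)).trans ?_
    refine (reach_eat (s' := 1) zero_le_one (by ring) rfl).trans ?_
    rw [show (2 * (r + 1)) • {y + 1} + G = (2 * r) • {y + 1} + (2 • {y + 1} + G) by module]
    exact ih _

/-- With `2 ^ (n + 1) - 1` bananas and one unit in the stomach at `y`, the camel can go `n + 1`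
miles further, less `z / 2`, and end at `y - z`. -/
theorem exists_reach_explore {z : ℝ} (hz0 : 0 ≤ z) (hz1 : z ≤ 1) (n : ℕ) :
    ∀ (y : ℝ) (M : ℕ) (G : Multiset ℝ), z ≤ y → M + 1 = 2 ^ (n + 1) → ∃ σ : State,
      Reach 2 ⟨y, 1, 0, M • {y} + G⟩ σ ∧ σ.pos = y + (n + 1) - z / 2 ∧
      Reach 2 σ ⟨y - z, 0, 0, G⟩ := by
  induction n with
  | zero =>
    intro y M G hzy hM
    obtain rfl : M = 1 := by omega
    refine ⟨⟨y + 1 - z / 2, 1 + z / 2, 0, G⟩, ?_, by simp, ?_⟩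
    · refine (reach_eat (s' := 2) (G' := G) le_rfl (by ring) (by module)).trans ?_
      exact reach_out (by linarith) (by linarith) (by linarith) (by ring)
    · exact reach_in (by linarith) (by linarith) le_rfl (by ring)
  | succ n ih =>
    intro y M G hzy hM
    obtain ⟨q, hq⟩ : ∃ q, 2 ^ n = q + 1 := Nat.exists_eq_succ_of_ne_zero (by positivity)
    have hM' : M = 4 * q + 3 := by
      rw [pow_succ, pow_succ, hq] at hM
      omega
    subst hM'
    obtain ⟨σ, h1, h2, h3⟩ := ih (y + 1) (2 * q + 1) ({y + 1 - z} + G) (by linarith)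
      (by rw [pow_succ, hq]; ring)
    refine ⟨σ, Relation.ReflTransGen.trans ?_ h1, by rw [h2]; push_cast; ring, h3.trans ?_⟩
    · rw [show (4 * q + 3) • {y} + G = (4 * q) • {y} + (3 • {y} + G) by module]
      refine (reach_shuttle (by linarith) q _).trans ?_
      refine (reach_eat (s' := 2) (G' := 2 • {y} + ((2 * q) • {y + 1} + G)) le_rfl (by ring)
        (by module)).trans ?_
      refine (reach_load_two rfl).trans ?_
      refine (reach_out (y := y + 1 - z) (s' := 1 + z) (by linarith) (by linarith) (by linarith)
        (by ring)).trans ?_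
      refine (reach_unload rfl).trans ?_
      refine (reach_out (y := y + 1) (s' := 1) (by linarith) (by linarith) zero_le_one
        (by ring)).trans ?_
      exact reach_unload (by module)
    · refine (reach_eat (s' := 1) zero_le_one (by ring) rfl).trans ?_
      exact reach_in (by linarith) (by linarith) le_rfl (by ring)

theorem reach_transport_start {N x t : ℝ} {n : ℕ} (hx0 : 0 ≤ x) (hx1 : x ≤ 1) (ht0 : 0 ≤ t)
    (ht1 : t ≤ 1) (h : N = 2 ^ (n + 1) + (2 ^ (n + 1) - 1) * x + t) :
    Reach 2 (start N) ⟨x, t, 0, (2 ^ (n + 1)) • {x}⟩ := by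
  obtain ⟨r, hr⟩ : ∃ r, 2 ^ n = r + 1 := Nat.exists_eq_succ_of_ne_zero (by positivity)
  have hr' : (2 : ℝ) ^ (n + 1) = 2 * (r + 1) := by
    rw [pow_succ]
    have : (2 : ℝ) ^ n = r + 1 := by exact_mod_cast hr
    rw [this]
    ring
  have hr'' : 2 ^ (n + 1) = 2 * (r + 1) := by rw [pow_succ, hr, mul_comm]
  rw [hr'] at h
  have hrx : 0 ≤ r * x := by positivity
  have hN : 2 * (r + 1) ≤ ⌊N⌋₊ := Nat.le_floor (by push_cast; linarith)
  obtain ⟨e, he⟩ := Nat.exists_eq_add_of_le hN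
  have hfl : ((⌊N⌋₊ : ℕ) : ℝ) = ((⌊N⌋ : ℤ) : ℝ) :=
    natCast_floor_eq_intCast_floor (by linarith [(Nat.cast_nonneg r : (0 : ℝ) ≤ r)])
  have hfr := Int.fract_add_floor N
  rw [← hfl, he] at hfr
  push_cast at hfr
  have := (reach_transport hx0 hx1 ht0 ht1 r).1 (Int.fract N) e 0 (Int.fract_nonneg N)
    (by linarith [Int.fract_lt_one N]) (by linarith)
  rw [add_zero, add_zero, ← he, Multiset.nsmul_singleton] at this
  rw [hr'']
  exact this

theorem mem_roundTripDepths_of_thrifty {N z : ℝ} (n : ℕ) (hz0 : 0 ≤ z) (hz1 : z ≤ 1)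
    (h : N = 2 ^ (n + 1) + (2 ^ (n + 1) - 1) * z) : (n + 1) + z / 2 ∈ roundTripDepths 2 N := by
  obtain ⟨M, hM⟩ : ∃ M, 2 ^ (n + 1) = M + 1 := Nat.exists_eq_succ_of_ne_zero (by positivity)
  have h1 := reach_transport_start hz0 hz1 le_rfl zero_le_one (h.trans (add_zero _).symm)
  obtain ⟨σ, h2, h3, h4⟩ := exists_reach_explore hz0 hz1 n z M 0 le_rfl hM.symm
  refine ⟨σ, _, (h1.trans ?_).trans h2, by rw [h3]; ring, h4, sub_self z⟩
  rw [hM]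
  exact reach_eat zero_le_one (by ring) (by module)

theorem mem_roundTripDepths_of_wasteful {N x : ℝ} (n : ℕ) (hx0 : 0 ≤ x) (hx1 : x ≤ 1)
    (h : N = 2 ^ (n + 1) + (2 ^ (n + 1) - 1) * x + 1) : (n + 1) + x ∈ roundTripDepths 2 N := by
  obtain ⟨M, hM⟩ : ∃ M, 2 ^ (n + 1) = M + 1 := Nat.exists_eq_succ_of_ne_zero (by positivity)
  have h1 := reach_transport_start hx0 hx1 zero_le_one le_rfl h
  obtain ⟨σ, h2, h3, h4⟩ := exists_reach_explore le_rfl zero_le_one n x M {x} hx0 hM.symm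
  rw [hM, show (M + 1) • ({x} : Multiset ℝ) = M • {x} + {x} by module] at h1
  rw [sub_zero] at h4
  refine ⟨σ, ⟨0, 1 - x, 0, 0⟩, h1.trans h2, by rw [h3]; ring, h4.trans ?_, rfl⟩
  refine (reach_eat (s' := 1) (G' := 0) zero_le_one (by ring) (by module)).trans ?_
  exact reach_in le_rfl hx0 (by linarith) (by ring)

theorem half_mem_roundTripDepths {N : ℝ} (h3 : 3 ≤ N) (h4 : N < 4) :
    N / 2 ∈ roundTripDepths 2 N := by
  have hfl : ⌊N⌋₊ = 3 := by
    rw [Nat.floor_eq_iff (by linarith)]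
    norm_num
    exact ⟨h3, h4⟩
  have hfr : Int.fract N = N - 3 := by
    rw [Int.fract_eq_iff]
    exact ⟨by linarith, by linarith, 3, by norm_num⟩
  refine ⟨⟨N / 2, N / 2, 0, 0⟩, ⟨0, 0, 0, 0⟩, ?_, rfl,
    reach_in le_rfl (by linarith) le_rfl (by ring), rfl⟩
  unfold start
  rw [hfl, hfr, ← Multiset.nsmul_singleton]
  refine (reach_eat (s' := N - 2) (G' := 2 • {0}) (by linarith) (by ring) (by module)).trans ?_
  refine (reach_load_two (G' := 0) (by module)).trans ?_
  refine (reach_out (y := N - 3) (s' := 1) (by linarith) (by linarith) zero_le_one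
    (by ring)).trans ?_
  refine (reach_eatBack (k := 1) (s' := 2) le_rfl (by ring)).trans ?_
  refine (reach_out (y := N - 2) (s' := 1) (by linarith) (by linarith) zero_le_one
    (by ring)).trans ?_
  refine (reach_eatBack (k := 0) (s' := 2) le_rfl (by ring)).trans ?_
  exact reach_out (by linarith) (by linarith) (by linarith) (by ring)

theorem pInv_two_eq {N : ℝ} (n : ℕ) (h1 : 2 ^ n ≤ N) (h2 : N < 2 ^ (n + 1)) :
    pInv 2 N = n + (N - 2 ^ n) / 2 ^ n := by
  have hq : (0 : ℝ) < 2 ^ n := by positivity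
  have h := p_two_add n (f := (N - 2 ^ n) / 2 ^ n) (div_nonneg (by linarith) hq.le) (by
    rw [div_lt_one hq]
    rw [pow_succ] at h2
    linarith)
  have hN : (2 : ℝ) ^ n * (1 + (N - 2 ^ n) / 2 ^ n) = N := by
    field_simp
    ring
  rw [zpow_natCast, hN, Int.cast_natCast] at h
  rw [← pInv_p 2 two_pos (n + (N - 2 ^ n) / 2 ^ n), h]

theorem exists_mem_roundTripDepths_gt {N : ℝ} (hN : 2 ≤ N) :
    ∃ d ∈ roundTripDepths 2 N, pInv 2 N - 1 / (N - 1) < d := by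
  obtain ⟨n, h1, h2⟩ := exists_nat_pow_near (show 1 ≤ N / 2 by linarith) one_lt_two
  have h3 : 2 ^ (n + 1) ≤ N := by rw [pow_succ]; linarith
  have h4 : N < 2 ^ (n + 1 + 1) := by rw [pow_succ]; linarith
  rw [pInv_two_eq (n + 1) h3 h4]
  have hn : (1 : ℝ) ≤ 2 ^ n := one_le_pow₀ one_le_two
  rw [pow_succ] at h4
  obtain ⟨q, hq⟩ : ∃ q : ℝ, q = 2 ^ (n + 1) := ⟨_, rfl⟩
  have hq2 : 2 ≤ q := by rw [hq, pow_succ]; linarith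
  rw [← hq] at h3 h4 ⊢
  push_cast
  rcases le_or_gt N (q + 1) with h5 | h5
  · refine ⟨_, mem_roundTripDepths_of_thrifty (z := (N - q) / (q - 1)) n
      (div_nonneg (by linarith) (by linarith))
      ((div_le_one (by linarith)).2 (by linarith)) ?_, ?_⟩
    · rw [← hq, mul_div_cancel₀ _ (by linarith)]
      ring
    · have h6 : (N - q) / q ≤ 1 / (N - 1) := by
        rw [div_le_div_iff₀ (by linarith) (by linarith)]
        nlinarith
      rcases h3.eq_or_lt with h7 | h7
      · have : 0 < 1 / (N - 1) := one_div_pos.2 (by linarith)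
        rw [← h7] at this ⊢
        rw [sub_self, zero_div, zero_div, zero_div]
        linarith
      · have : 0 < (N - q) / (q - 1) := div_pos (by linarith) (by linarith)
        linarith
  · refine ⟨_, mem_roundTripDepths_of_wasteful (x := (N - q - 1) / (q - 1)) n
      (div_nonneg (by linarith) (by linarith))
      ((div_le_one (by linarith)).2 (by linarith)) ?_, ?_⟩
    · rw [← hq, mul_div_cancel₀ _ (by linarith)]
      ring
    · obtain ⟨x, hx⟩ : ∃ x, x = (N - q - 1) / (q - 1) := ⟨_, rfl⟩
      have hx0 : 0 < x := hx ▸ div_pos (by linarith) (by linarith)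
      rw [← hx]
      rw [eq_div_iff (by linarith)] at hx
      have h6 : (N - q) / q = x + (1 - x) / q := by
        field_simp
        linarith
      have h7 : (1 - x) / q < 1 / (N - 1) := by
        rw [div_lt_div_iff₀ (by linarith) (by linarith), show N - 1 = q + x * (q - 1) by linarith]
        have : 0 < x * x * (q - 1) := mul_pos (mul_pos hx0 hx0) (by linarith)
        nlinarith
      linarith

theorem pInv_two_pow_mem_roundTripDepths (n : ℕ) :
    pInv 2 (2 ^ (n + 1)) ∈ roundTripDepths 2 (2 ^ (n + 1)) := by
  have := mem_roundTripDepths_of_thrifty (N := 2 ^ (n + 1)) n le_rfl zero_le_one (by ring)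
  rw [pInv_two_eq (n + 1) le_rfl (pow_lt_pow_right₀ one_lt_two (Nat.lt_succ_self _))]
  simpa using this

theorem pInv_mem_roundTripDepths_of_lt_four {N : ℝ} (h2 : 2 ≤ N) (h4 : N < 4) :
    pInv 2 N ∈ roundTripDepths 2 N := by
  have h : pInv 2 N = N / 2 := by
    rw [pInv_two_eq 1 (by linarith) (by norm_num; linarith)]
    push_cast
    ring
  rw [h]
  rcases le_total N 3 with h3 | h3
  · convert mem_roundTripDepths_of_thrifty (N := N) (z := N - 2) 0 (by linarith) (by linarith)
      (by ring) using 1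
    push_cast
    ring
  · exact half_mem_roundTripDepths h3 h4

theorem isGreatest_of_le_six {N : ℝ} (h4 : 4 ≤ N) (h6 : N ≤ 6) :
    IsGreatest (roundTripDepths 2 N) ((N - 4) / 6 + 2) := by
  constructor
  · convert mem_roundTripDepths_of_thrifty (N := N) (z := (N - 4) / 3) 1 (by linarith)
      (by linarith) (by ring) using 1
    push_cast
    ring
  · intro d hd
    rcases le_or_gt d 0 with h0 | h0
    · linarith
    · rcases le_or_le_of_mem_roundTripDepths (by linarith) h0 hd with h | h <;> linarith

theorem isGreatest_of_six_le {N : ℝ} (h6 : 6 ≤ N) (h8 : N ≤ 8) :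
    IsGreatest (roundTripDepths 2 N) ((N - 5) / 3 + 2) := by
  constructor
  · convert mem_roundTripDepths_of_wasteful (N := N) (x := (N - 5) / 3) 1 (by linarith)
      (by linarith) (by ring) using 1
    push_cast
    ring
  · intro d hd
    rcases le_or_gt d 0 with h0 | h0
    · linarith
    · rcases le_or_le_of_mem_roundTripDepths (by linarith) h0 hd with h | h <;> linarith

end Camel

theorem mainTheorem3 (N : ℝ) (hN : 2 ≤ N) :
    -- the estimate of the penetration depth
    Camel.pInv 2 N ∈ upperBounds (Camel.roundTripDepths 2 N) ∧
    (∃ d ∈ Camel.roundTripDepths 2 N, Camel.pInv 2 N - 1 / (N - 1) < d) ∧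
    -- cases in which the upper bound is attained
    ((N ≤ 4 ∨ ∃ k : ℕ, 1 ≤ k ∧ N = 2 ^ k) →
      Camel.pInv 2 N ∈ Camel.roundTripDepths 2 N) ∧
    -- the upper bound is not attained between 4 and 8
    (4 < N → N < 8 →
      Camel.pInv 2 N = (N - 4) / 4 + 2 ∧ Camel.pInv 2 N ∉ Camel.roundTripDepths 2 N) ∧
    -- the exact penetration depth between 4 and 8
    (4 ≤ N → N ≤ 6 → IsGreatest (Camel.roundTripDepths 2 N) ((N - 4) / 6 + 2)) ∧
    (6 ≤ N → N ≤ 8 → IsGreatest (Camel.roundTripDepths 2 N) ((N - 5) / 3 + 2)) := by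

  refine ⟨Camel.pInv_mem_upperBounds hN, Camel.exists_mem_roundTripDepths_gt hN, ?_, ?_,
    Camel.isGreatest_of_le_six, Camel.isGreatest_of_six_le⟩
  · rintro (h | ⟨k, hk, rfl⟩)
    · rcases h.eq_or_lt with rfl | h
      · have := Camel.pInv_two_pow_mem_roundTripDepths 1
        norm_num at this
        exact this
      · exact Camel.pInv_mem_roundTripDepths_of_lt_four hN h
    · obtain ⟨n, rfl⟩ := Nat.exists_eq_add_of_le' hk
      exact Camel.pInv_two_pow_mem_roundTripDepths n
  · intro h4 h8
    have h : Camel.pInv 2 N = (N - 4) / 4 + 2 := by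
      rw [Camel.pInv_two_eq 2 (by linarith) (by norm_num; linarith)]
      push_cast
      ring
    refine ⟨h, fun hmem => ?_⟩
    rw [h] at hmem
    rcases le_total N 6 with h6 | h6
    · have := (Camel.isGreatest_of_le_six h4.le h6).2 hmem
      linarith
    · have := (Camel.isGreatest_of_six_le h6 h8.le).2 hmem
      linarith
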